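/- Let $p$ be a prime and let $k\ge 0$ and $0\le t\le k$ be integers. Let $\lambda_1\ge\lambda_2\ge\dots\ge\lambda_k\ge 1$ be integers such that $\lambda_j\ge 2$ for $1\le j\le t$ and $\lambda_j=1$ for $t<j\le k$, and let $G$ be a finite abelian $p$-group of type $\lambda=(\lambda_1,\dots,\lambda_k)$, that is, $G\cong\mathbb{Z}_{p^{\lambda_1}}\times\mathbb{Z}_{p^{\lambda_2}}\times\cdots\times\mathbb{Z}_{p^{\lambda_k}}$. Then the number of subgroups of $G$ of exponent $p^2$ is $$\sum_{\substack{1\le r\le t\\ 0\le s\le k-r}} p^{r(k-r-s)}\binom{k-r}{s}_{p}\binom{t}{r}_{p},$$ which is zero (empty sum) for $t=0$. Here, for integers $0\le m\le n$, $$\binom{n}{m}_{p}=\frac{\prod_{i=1}^{n}(p^i-1)}{\prod_{i=1}^{m}(p^i-1)\,\prod_{i=1}^{n-m}(p^i-1)}$$ is the Gaussian binomial coefficient (empty products are equal to $1$). -/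

import Mathlib

/-- The Gaussian binomial coefficient, given by
`∏_{i=1}^n (q^i - 1) / (∏_{i=1}^m (q^i - 1) * ∏_{i=1}^{n-m} (q^i - 1))` for `m ≤ n`
(and `0` for `m > n`); it is a rational number, used below for a prime `q`. -/
def gaussBinom (q n m : ℕ) : ℚ :=
  if m ≤ n then
    (∏ i ∈ Finset.Icc 1 n, ((q : ℚ) ^ i - 1)) /
      ((∏ i ∈ Finset.Icc 1 m, ((q : ℚ) ^ i - 1)) *
        ∏ i ∈ Finset.Icc 1 (n - m), ((q : ℚ) ^ i - 1))
  else 0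

/-- The set of subgroups of exponent `d` of an (additively written) abelian group `G`. -/
def subgroupsOfExponent (d : ℕ) (G : Type*) [AddCommGroup G] : Set (AddSubgroup G) :=
  {H | AddMonoid.exponent H = d}

/-- `G` is the abelian `p`-group of type `(lam 0, …, lam (k - 1))`: it is isomorphic to the
product of the cyclic groups of order `p ^ lam i`, where `lam` is non-increasing with
positive entries. -/
def HasType (p : ℕ) {k : ℕ} (lam : Fin k → ℕ) (G : Type*) [AddCommGroup G] : Prop :=
  Antitone lam ∧ (∀ i, 1 ≤ lam i) ∧ Nonempty (G ≃+ ((i : Fin k) → ZMod (p ^ lam i)))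

/-!
Let `V = G[p]`, let `f : G → G` be multiplication by `p`, and let `W = pG ∩ G[p]`. A subgroup `H`
has exponent `p ^ 2` exactly when `p • H` is a nontrivial subgroup of `W`
(`exponent_eq_prime_sq_iff`), and such an `H` is sorted by the pair `R = p • H`, `S = H ∩ V`, for
which `R ≤ S ≤ V` and `R ≤ W`. For a group of type `lam` the elementary abelian groups `V` and `W`
have ranks `k` and `t`.

Given `(R, S)` with `R` of rank `r` and `S` of rank `r + s`, put `P = f⁻¹(R)`. Then `P / S` is
elementary abelian, since `pP ⊆ R ⊆ S`, and the subgroups `H` belonging to `(R, S)` are the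
complements of `V / S` in `P / S` (`card_map_eq_and_inf_eq`). Complements of a subspace `A` of `E`
are parametrised by `Hom(E / A, A)` (`Submodule.card_isCompl`); as `P / V ≅ R` has rank `r` and
`V / S` has rank `k - r - s`, there are `p ^ (r * (k - r - s))` of them. The choices of `R` in `W`
and of `S / R` in `V / R` are counted by Gaussian binomial coefficients
(`card_between_eq_gaussBinom`), which arise as the quotient of the numbers of linearly independent
tuples in the whole space and in a subspace (`card_submodule_finrank_eq`).
-/

open Module

/-! ### The interval between two subgroups -/

/-- The subgroups of `B ⧸ A` correspond to the subgroups between `A` and `B`. -/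
def AddSubgroup.quotientOrderIsoIcc {G : Type*} [AddCommGroup G] (A B : AddSubgroup G) (h : A ≤ B) :
    AddSubgroup (B ⧸ A.addSubgroupOf B) ≃o Set.Icc A B where
  toFun K := ⟨(K.comap (QuotientAddGroup.mk' (A.addSubgroupOf B))).map B.subtype, by
    refine ⟨fun x hx => ⟨⟨x, h hx⟩, ?_, rfl⟩, AddSubgroup.map_subtype_le _⟩
    exact QuotientAddGroup.le_comap_mk' _ K hx⟩
  invFun H := (H.1.addSubgroupOf B).map (QuotientAddGroup.mk' (A.addSubgroupOf B))
  left_inv K := by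
    have h1 : ((K.comap (QuotientAddGroup.mk' (A.addSubgroupOf B))).map B.subtype).addSubgroupOf B =
      K.comap (QuotientAddGroup.mk' (A.addSubgroupOf B)) :=
      AddSubgroup.comap_map_eq_self_of_injective B.subtype_injective _
    exact (congrArg _ h1).trans
      (AddSubgroup.map_comap_eq_self_of_surjective (QuotientAddGroup.mk'_surjective _) K)
  right_inv H := by
    ext1
    have h1 : (A.addSubgroupOf B) ⊔ (H.1.addSubgroupOf B) = H.1.addSubgroupOf B :=
      sup_eq_right.2 (AddSubgroup.comap_mono H.2.1)
    simp only [QuotientAddGroup.comap_map_mk', h1, AddSubgroup.addSubgroupOf_map_subtype,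
      inf_eq_left.2 H.2.2]
  map_rel_iff' {K L} :=
    (AddSubgroup.map_le_map_iff_of_injective B.subtype_injective).trans
      (AddSubgroup.comap_le_comap_of_surjective (QuotientAddGroup.mk'_surjective _))

theorem AddSubgroup.card_quotient_addSubgroupOf_mul {G : Type*} [AddCommGroup G]
    {A B : AddSubgroup G} (h : A ≤ B) :
    Nat.card (B ⧸ A.addSubgroupOf B) * Nat.card A = Nat.card B := by
  rw [AddSubgroup.card_eq_card_quotient_mul_card_addSubgroup (A.addSubgroupOf B),
    Nat.card_congr (AddSubgroup.addSubgroupOfEquivOfLe h).toEquiv]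

theorem AddSubgroup.card_quotientOrderIsoIcc {G : Type*} [AddCommGroup G] [Finite G]
    (A B : AddSubgroup G) (h : A ≤ B) (K : AddSubgroup (B ⧸ A.addSubgroupOf B)) :
    Nat.card (quotientOrderIsoIcc A B h K : AddSubgroup G) = Nat.card K * Nat.card A := by
  have h1 : Nat.card (quotientOrderIsoIcc A B h K : AddSubgroup G) =
      Nat.card (K.comap (QuotientAddGroup.mk' (A.addSubgroupOf B))) :=
    AddSubgroup.card_map_of_injective B.subtype_injective
  have h2 := K.index_comap_of_surjective (QuotientAddGroup.mk'_surjective (A.addSubgroupOf B))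
  have h3 := (K.comap (QuotientAddGroup.mk' (A.addSubgroupOf B))).card_mul_index
  have h4 := K.card_mul_index
  -- `K` and its preimage in `B` have the same index, so their orders have the ratio `|A|`
  have h5 : 0 < K.index := Nat.pos_of_ne_zero AddSubgroup.index_ne_zero_of_finite
  rw [h2, ← h1, ← card_quotient_addSubgroupOf_mul h, ← h4] at h3
  apply Nat.eq_of_mul_eq_mul_right h5
  rw [h3]; ring

/-! ### Counting subspaces and complements -/

/-- Choosing a linearly independent `m`-tuple amounts to choosing its span, a subspace of
dimension `m`, and then a basis of it. -/
theorem card_linearIndependent_eq_mul {K V : Type*} [Field K] [Fintype K] [AddCommGroup V]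
    [Module K V] [Finite V] (m : ℕ) :
    Nat.card {s : Fin m → V // LinearIndependent K s} =
      Nat.card {S : Submodule K V // finrank K S = m} *
        ∏ i : Fin m, (Fintype.card K ^ m - Fintype.card K ^ i.val) := by
  have : Finite (Submodule K V) := Finite.of_injective _ SetLike.coe_injective
  have := Fintype.ofFinite {S : Submodule K V // finrank K S = m}
  -- `g` forgets that the vectors of a basis lie in the subspace that they span
  let g : (Σ S : {S : Submodule K V // finrank K S = m},
      {s : Fin m → S.1 // LinearIndependent K s}) → {s : Fin m → V // LinearIndependent K s} :=
    fun x => ⟨fun i => x.2.1 i, x.2.2.map' x.1.1.subtype (Submodule.ker_subtype _)⟩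
  have hspan : ∀ x, Submodule.span K (Set.range (g x).1) = x.1.1 := by
    rintro ⟨⟨S, hS⟩, s, hs⟩
    have h1 := hs.span_eq_top_of_card_eq_finrank' (by simp [hS])
    have h2 := congrArg (Submodule.map S.subtype) h1
    rw [Submodule.map_span, Submodule.map_subtype_top, ← Set.range_comp] at h2
    exact h2
  have hg : Function.Bijective g := by
    constructor
    · intro x y hxy
      have h1 : x.1 = y.1 := Subtype.ext (by rw [← hspan x, ← hspan y, hxy])
      obtain ⟨S, s, hs⟩ := x
      obtain ⟨T, t, ht⟩ := y
      obtain rfl : S = T := h1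
      congr
      funext i
      exact Subtype.ext (congrFun (congrArg Subtype.val hxy) i)
    · rintro ⟨s, hs⟩
      refine ⟨⟨⟨Submodule.span K (Set.range s), by simpa using finrank_span_eq_card hs⟩,
        fun i => ⟨s i, Submodule.subset_span ⟨i, rfl⟩⟩, ?_⟩, rfl⟩
      exact LinearIndependent.of_comp (Submodule.subtype _) hs
  rw [← Nat.card_congr (Equiv.ofBijective g hg), Nat.card_sigma,
    Finset.sum_congr rfl (g := fun _ => ∏ i : Fin m, (Fintype.card K ^ m - Fintype.card K ^ i.val))]
  · simp
  · rintro ⟨S, hS⟩ -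
    rw [card_linearIndependent hS.ge, hS]

theorem prod_Icc_pow_sub_one_ne_zero {q : ℕ} (hq : 1 < q) (n : ℕ) :
    ∏ i ∈ Finset.Icc 1 n, ((q : ℚ) ^ i - 1) ≠ 0 := by
  refine Finset.prod_ne_zero_iff.2 fun i hi => ?_
  have : (1 : ℚ) < (q : ℚ) ^ i :=
    one_lt_pow₀ (by exact_mod_cast hq) (by have := Finset.mem_Icc.1 hi; omega)
  exact sub_ne_zero.2 this.ne'

/-- The number of linearly independent `m`-tuples in dimension `n`, freed of its powers of `q`. -/
theorem prod_pow_sub_pow_mul (q : ℚ) {n m : ℕ} (h : m ≤ n) :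
    (∏ i ∈ Finset.range m, (q ^ n - q ^ i)) * ∏ i ∈ Finset.Icc 1 (n - m), (q ^ i - 1) =
      (∏ i ∈ Finset.range m, q ^ i) * ∏ i ∈ Finset.Icc 1 n, (q ^ i - 1) := by
  induction m with
  | zero => simp
  | succ m ih =>
    rw [Finset.prod_range_succ, Finset.prod_range_succ, mul_right_comm _ (q ^ m), ← ih (by omega)]
    obtain ⟨d, rfl⟩ := Nat.exists_eq_add_of_le h
    have h1 : m + 1 + d - m = d + 1 := by omega
    have h2 : m + 1 + d - (m + 1) = d := by omega
    rw [h1, h2, Finset.prod_Icc_succ_top (by omega)]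
    ring

/-- Both sides of `card_linearIndependent_eq_mul` are known products; their quotient is the Gaussian
binomial coefficient. For `m` above the dimension both sides vanish. -/
theorem card_submodule_finrank_eq {K V : Type*} [Field K] [Fintype K] [AddCommGroup V]
    [Module K V] [Finite V] (m : ℕ) :
    (Nat.card {S : Submodule K V // finrank K S = m} : ℚ) =
      gaussBinom (Fintype.card K) (finrank K V) m := by
  have hq : 1 < Fintype.card K := Fintype.one_lt_card
  have hq' : (Fintype.card K : ℚ) ≠ 0 := by positivity
  unfold gaussBinom
  split_ifs with h
  · have h1 := card_linearIndependent_eq_mul (K := K) (V := V) m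
    rw [card_linearIndependent h,
      Fin.prod_univ_eq_prod_range (fun i => Fintype.card K ^ finrank K V - Fintype.card K ^ i),
      Fin.prod_univ_eq_prod_range (fun i => Fintype.card K ^ m - Fintype.card K ^ i)] at h1
    have cast : ∀ n, m ≤ n →
        ((∏ i ∈ Finset.range m, (Fintype.card K ^ n - Fintype.card K ^ i) : ℕ) : ℚ) =
          ∏ i ∈ Finset.range m, ((Fintype.card K : ℚ) ^ n - (Fintype.card K : ℚ) ^ i) := by
      intro n hn
      rw [Nat.cast_prod]
      refine Finset.prod_congr rfl fun i hi => ?_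
      rw [Nat.cast_sub (Nat.pow_le_pow_right hq.le ((Finset.mem_range.1 hi).le.trans hn))]
      simp
    have h2 := congrArg (Nat.cast : ℕ → ℚ) h1
    rw [Nat.cast_mul, cast _ h, cast _ le_rfl] at h2
    have h3 := prod_pow_sub_pow_mul (Fintype.card K : ℚ) h
    have h4 := prod_pow_sub_pow_mul (Fintype.card K : ℚ) (le_refl m)
    rw [h2] at h3
    simp only [Nat.sub_self, Finset.Icc_eq_empty_of_lt zero_lt_one, Finset.prod_empty,
      mul_one] at h4
    rw [h4] at h3
    rw [eq_div_iff (mul_ne_zero (prod_Icc_pow_sub_one_ne_zero hq _)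
      (prod_Icc_pow_sub_one_ne_zero hq _))]
    have h5 : ∏ i ∈ Finset.range m, (Fintype.card K : ℚ) ^ i ≠ 0 :=
      Finset.prod_ne_zero_iff.2 fun i _ => pow_ne_zero i hq'
    apply mul_left_cancel₀ h5
    rw [← h3]; ring
  · have : IsEmpty {S : Submodule K V // finrank K S = m} :=
      ⟨fun S => h (S.2 ▸ Submodule.finrank_le S.1)⟩
    simp

/-- The complements of a subspace `A` are parametrised by the linear maps from one of them
to `A`. -/
theorem Submodule.card_isCompl {K V : Type*} [Field K] [AddCommGroup V] [Module K V]
    [Finite V] (A : Submodule K V) :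
    Nat.card {C : Submodule K V // IsCompl A C} =
      Nat.card K ^ (finrank K (V ⧸ A) * finrank K A) := by
  obtain ⟨C, hC⟩ := A.exists_isCompl
  have e : {f : V →ₗ[K] A // ∀ x : A, f x = x} ≃ (C →ₗ[K] A) :=
    { toFun := fun f => f.1 ∘ₗ C.subtype
      invFun := fun g => ⟨LinearMap.ofIsCompl hC LinearMap.id g, by simp⟩
      left_inv := fun f => by
        ext1
        refine LinearMap.ofIsCompl_eq hC ?_ ?_ <;> simp [f.2]
      right_inv := fun g => by ext; simp }
  rw [Nat.card_congr A.isComplEquivProj, Nat.card_congr e, Module.natCard_eq_pow_finrank (K := K),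
    finrank_linearMap, (A.quotientEquivOfIsCompl C hC).finrank_eq]

/-! ### Elementary abelian sections of an abelian group -/

section Sections

variable {G : Type*} [AddCommGroup G] [Finite G] {p : ℕ} [Fact p.Prime]

omit [Finite G] [Fact p.Prime] in
theorem nsmul_quotient_addSubgroupOf_eq_zero {A B : AddSubgroup G} (h : ∀ x ∈ B, p • x ∈ A)
    (x : B ⧸ A.addSubgroupOf B) : p • x = 0 := by
  induction x using QuotientAddGroup.induction_on with
  | H x =>
    rw [← QuotientAddGroup.mk_nsmul, QuotientAddGroup.eq_zero_iff]
    exact h x x.2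

/-- If `B ⧸ A` is elementary abelian of rank `n`, the subgroups between `A` and `B` in which
`A` has index `p ^ m` are counted by a Gaussian binomial coefficient. -/
theorem card_between_eq_gaussBinom {A B : AddSubgroup G} (hAB : A ≤ B) (h : ∀ x ∈ B, p • x ∈ A)
    {n : ℕ} (hn : Nat.card B = p ^ n * Nat.card A) (m : ℕ) :
    (Nat.card {H : AddSubgroup G // (A ≤ H ∧ H ≤ B) ∧ Nat.card H = p ^ m * Nat.card A} : ℚ) =
      gaussBinom p n m := by
  have hp : p.Prime := Fact.out
  have : Module (ZMod p) (B ⧸ A.addSubgroupOf B) :=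
    AddCommGroup.zmodModule (nsmul_quotient_addSubgroupOf_eq_zero h)
  have hA : 0 < Nat.card A := Nat.card_pos
  have hfin : finrank (ZMod p) (B ⧸ A.addSubgroupOf B) = n := by
    have h1 := AddSubgroup.card_quotient_addSubgroupOf_mul hAB
    rw [hn, Module.natCard_eq_pow_finrank (K := ZMod p), Nat.card_zmod] at h1
    exact Nat.pow_right_injective hp.two_le (Nat.eq_of_mul_eq_mul_right hA h1)
  have h2 := card_submodule_finrank_eq (K := ZMod p) (V := B ⧸ A.addSubgroupOf B) m
  rw [hfin, ZMod.card] at h2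
  rw [← h2]
  congr 1
  let e := (AddSubgroup.toZModSubmodule (M := B ⧸ A.addSubgroupOf B) p).symm.trans
    (AddSubgroup.quotientOrderIsoIcc A B hAB)
  have he : ∀ S, Nat.card (e S : AddSubgroup G) = p ^ finrank (ZMod p) S * Nat.card A := by
    intro S
    have h3 : Nat.card S = p ^ finrank (ZMod p) S := by
      rw [Module.natCard_eq_pow_finrank (K := ZMod p), Nat.card_zmod]
    rw [← h3]
    exact AddSubgroup.card_quotientOrderIsoIcc A B hAB _
  refine Nat.card_congr (Equiv.trans (Equiv.subtypeEquiv e.toEquiv fun S => ?_)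
    (Equiv.subtypeSubtypeEquivSubtypeInter (fun H => H ∈ Set.Icc A B)
      (fun H : AddSubgroup G => Nat.card H = p ^ m * Nat.card A))).symm
  change _ ↔ Nat.card (e S : AddSubgroup G) = _
  rw [he, Nat.mul_left_inj hA.ne', Nat.pow_right_inj hp.one_lt]

/-- The subgroups `H` in question are the preimages of the complements of `V ⧸ S` in the elementary
abelian section `P ⧸ S`, in which `V ⧸ S` has rank `a` and corank `r`. -/
theorem card_relative_complements {S V P : AddSubgroup G} (hSV : S ≤ V) (hVP : V ≤ P)
    (h : ∀ x ∈ P, p • x ∈ S) {a r : ℕ} (ha : Nat.card V = p ^ a * Nat.card S)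
    (hr : Nat.card P = p ^ r * Nat.card V) :
    Nat.card {H : AddSubgroup G // V ⊓ H = S ∧ V ⊔ H = P} = p ^ (r * a) := by
  have hp : p.Prime := Fact.out
  have hSP := hSV.trans hVP
  have : Fact (S ≤ P) := ⟨hSP⟩
  have : Module (ZMod p) (P ⧸ S.addSubgroupOf P) :=
    AddCommGroup.zmodModule (nsmul_quotient_addSubgroupOf_eq_zero h)
  have hS : 0 < Nat.card S := Nat.card_pos
  let e := (AddSubgroup.toZModSubmodule (M := P ⧸ S.addSubgroupOf P) p).symm.trans
    (AddSubgroup.quotientOrderIsoIcc S P hSP)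
  let A := e.symm ⟨V, hSV, hVP⟩
  have hA : e A = ⟨V, hSV, hVP⟩ := e.apply_symm_apply _
  have hcard : Nat.card A = p ^ a := by
    have h1 : Nat.card (e A : AddSubgroup G) = Nat.card A * Nat.card S :=
      AddSubgroup.card_quotientOrderIsoIcc S P hSP _
    rw [hA, ha] at h1
    exact (Nat.eq_of_mul_eq_mul_right hS h1).symm
  have hfA : finrank (ZMod p) A = a := by
    rw [Module.natCard_eq_pow_finrank (K := ZMod p), Nat.card_zmod] at hcard
    exact Nat.pow_right_injective hp.two_le hcard
  have hfQ : finrank (ZMod p) (P ⧸ S.addSubgroupOf P) = r + a := by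
    have h1 := AddSubgroup.card_quotient_addSubgroupOf_mul hSP
    rw [hr, ha, Module.natCard_eq_pow_finrank (K := ZMod p), Nat.card_zmod, ← mul_assoc,
      ← pow_add] at h1
    exact Nat.pow_right_injective hp.two_le (Nat.eq_of_mul_eq_mul_right hS h1)
  have hfr : finrank (ZMod p) ((P ⧸ S.addSubgroupOf P) ⧸ A) = r := by
    have := A.finrank_quotient_add_finrank
    omega
  have h2 := A.card_isCompl
  rw [hfA, hfr, Nat.card_zmod] at h2
  rw [← h2]
  refine Nat.card_congr ((Equiv.subtypeEquiv e.toEquiv (q := fun H : Set.Icc S P =>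
    V ⊓ H = S ∧ V ⊔ H = P) fun C => ?_).trans
    (Equiv.subtypeSubtypeEquivSubtype (p := fun H => H ∈ Set.Icc S P)
      (q := fun H => V ⊓ H = S ∧ V ⊔ H = P) fun {H} hH => ?_)).symm
  · rw [e.isCompl_iff, hA, Set.Icc.isCompl_iff]
    rfl
  · exact ⟨hH.1 ▸ inf_le_right, hH.2 ▸ le_sup_right⟩

end Sections

/-! ### Counting by fibres -/

theorem Nat.card_subtype_eq_sum_card {α β : Type*} [Finite α] [DecidableEq β] {P : α → Prop}
    (g : α → β) (I : Finset β) (hg : ∀ x, P x → g x ∈ I) :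
    Nat.card {x // P x} = ∑ i ∈ I, Nat.card {x // P x ∧ g x = i} := by
  classical
  have := Fintype.ofFinite α
  simp only [Nat.card_eq_fintype_card, Fintype.card_subtype]
  rw [Finset.card_eq_sum_card_fiberwise (f := g) (t := I) (by simpa [Set.MapsTo] using hg)]
  simp only [Finset.filter_filter]

/-- If `g` maps the `x` with `P x` to the `y` with `Q y`, all fibres being of size `c`, the counts
differ by the factor `c`. -/
theorem Nat.card_subtype_eq_mul {α β : Type*} [Finite α] [Finite β] {P : α → Prop} {Q : β → Prop}
    (g : α → β) (hg : ∀ x, P x → Q (g x)) {c : ℚ}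
    (hc : ∀ y, Q y → (Nat.card {x // P x ∧ g x = y} : ℚ) = c) :
    (Nat.card {x // P x} : ℚ) = c * Nat.card {y // Q y} := by
  classical
  have := Fintype.ofFinite β
  rw [Nat.card_subtype_eq_sum_card g (Finset.univ.filter Q) (by simpa using hg), Nat.cast_sum,
    Finset.sum_congr rfl fun y hy => hc y (by simpa using hy), Finset.sum_const, nsmul_eq_mul,
    Nat.card_eq_fintype_card, Fintype.card_subtype, mul_comm]

/-! ### Subgroups of exponent `p ^ 2` -/

section Count

variable {G : Type*} [AddCommGroup G]

theorem AddSubgroup.card_map_mul_card_ker {G' : Type*} [AddCommGroup G'] (f : G →+ G')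
    {K : AddSubgroup G} (h : f.ker ≤ K) :
    Nat.card (K.map f) * Nat.card f.ker = Nat.card K := by
  rw [← AddSubgroup.card_quotient_addSubgroupOf_mul h, ← AddSubgroup.relIndex_ker]
  rfl

theorem AddSubgroup.exists_card_eq_pow_of_le [Finite G] {p : ℕ} (hp : p.Prime) {H K : AddSubgroup G}
    (h : H ≤ K) {n : ℕ} (hK : Nat.card K = p ^ n) : ∃ m ≤ n, Nat.card H = p ^ m :=
  (Nat.dvd_prime_pow hp).1 (hK ▸ AddSubgroup.card_dvd_of_le h)

/-- A subgroup `H` has exponent `p ^ 2` exactly when `p • H` is nontrivial and killed by `p`. -/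
theorem exponent_eq_prime_sq_iff {p : ℕ} (hp : p.Prime) (H : AddSubgroup G) :
    AddMonoid.exponent H = p ^ 2 ↔
      H.map (nsmulAddMonoidHom p) ≤ (nsmulAddMonoidHom p : G →+ G).range ⊓
          (nsmulAddMonoidHom p).ker ∧
        H.map (nsmulAddMonoidHom p) ≠ ⊥ := by
  have h1 : ∀ n, AddMonoid.exponent H ∣ n ↔ ∀ x ∈ H, n • x = 0 := by
    intro n
    rw [AddMonoid.exponent_dvd_iff_forall_nsmul_eq_zero]
    simp [Subtype.ext_iff]
  have h2 : H.map (nsmulAddMonoidHom p) ≤ (nsmulAddMonoidHom p : G →+ G).range ⊓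
      (nsmulAddMonoidHom p).ker ↔ AddMonoid.exponent H ∣ p ^ 2 := by
    rw [h1, le_inf_iff, and_iff_right (AddSubgroup.map_le_range _ _),
      AddSubgroup.map_le_iff_le_comap]
    simp [SetLike.le_def, AddSubgroup.mem_comap, AddMonoidHom.mem_ker, ← mul_nsmul, pow_two]
  have h3 : H.map (nsmulAddMonoidHom p) = ⊥ ↔ AddMonoid.exponent H ∣ p ^ 1 := by
    rw [h1, AddSubgroup.map_eq_bot_iff]
    simp [SetLike.le_def, AddMonoidHom.mem_ker]
  rw [h2, Ne, h3]
  constructor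
  · intro h
    rw [h]
    exact ⟨dvd_rfl, fun h => absurd ((Nat.pow_dvd_pow_iff_le_right hp.one_lt).1 h) (by norm_num)⟩
  · rintro ⟨h, h'⟩
    obtain ⟨m, hm, h4⟩ := (Nat.dvd_prime_pow hp).1 h
    rw [h4] at h' ⊢
    have : ¬ m ≤ 1 := fun h5 => h' (pow_dvd_pow p h5)
    rw [show m = 2 by omega]

variable [Finite G] {p : ℕ} [Fact p.Prime]

/-- For `R` in `pG` and `R ≤ S ≤ G[p]`, the subgroups `H` with `p • H = R` and `H ∩ G[p] = S` are
the relative complements of `G[p]` between `S` and the preimage of `R` under multiplication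
by `p`. -/
theorem card_map_eq_and_inf_eq {R S : AddSubgroup G}
    (hR : R ≤ (nsmulAddMonoidHom p : G →+ G).range) (hRS : R ≤ S)
    (hS : S ≤ (nsmulAddMonoidHom p : G →+ G).ker) {r a : ℕ} (hr : Nat.card R = p ^ r)
    (ha : Nat.card (nsmulAddMonoidHom p : G →+ G).ker = p ^ a * Nat.card S) :
    Nat.card {H : AddSubgroup G // H.map (nsmulAddMonoidHom p) = R ∧
      (nsmulAddMonoidHom p).ker ⊓ H = S} = p ^ (r * a) := by
  set f : G →+ G := nsmulAddMonoidHom p with hf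
  have hker : f.ker ≤ R.comap f := f.ker_le_comap R
  have hmc : (R.comap f).map f = R := AddSubgroup.map_comap_eq_self hR
  rw [← card_relative_complements (p := p) (P := R.comap f) hS hker (fun x hx => hRS hx) ha
    (by rw [← AddSubgroup.card_map_mul_card_ker f hker, hmc, hr])]
  refine Nat.card_congr (Equiv.subtypeEquivRight fun H => ?_)
  rw [and_comm]
  refine and_congr_right fun _ => ?_
  rw [sup_comm, ← AddSubgroup.comap_map_eq]
  refine ⟨fun h => h ▸ rfl, fun h => ?_⟩
  have h1 := congrArg (AddSubgroup.map f) h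
  rwa [hmc, AddSubgroup.map_comap_eq_self (AddSubgroup.map_le_range _ _)] at h1

/-- The number of subgroups `H` with `p • H` of rank `r` in `pG ∩ G[p]` and `H ∩ G[p]` of
rank `r + s`. -/
theorem card_map_card_eq_and_card_inf_eq {k t r s : ℕ} (hrt : r ≤ t) (htk : t ≤ k) (hs : s ≤ k - r)
    (hk : Nat.card (nsmulAddMonoidHom p : G →+ G).ker = p ^ k)
    (ht : Nat.card ((nsmulAddMonoidHom p : G →+ G).range ⊓ (nsmulAddMonoidHom p).ker :
      AddSubgroup G) = p ^ t) :
    (Nat.card {H : AddSubgroup G // (H.map (nsmulAddMonoidHom p) ≤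
        (nsmulAddMonoidHom p).range ⊓ (nsmulAddMonoidHom p).ker ∧
        Nat.card (H.map (nsmulAddMonoidHom p)) = p ^ r) ∧
        Nat.card ((nsmulAddMonoidHom p).ker ⊓ H : AddSubgroup G) = p ^ s * p ^ r} : ℚ) =
      (p : ℚ) ^ (r * (k - r - s)) * gaussBinom p (k - r) s * gaussBinom p t r := by
  set f : G →+ G := nsmulAddMonoidHom p with hf
  set W := f.range ⊓ f.ker with hW
  have hp : p.Prime := Fact.out
  have hker : ∀ x ∈ f.ker, p • x = 0 := fun x hx => hx
  have hcR := card_between_eq_gaussBinom (p := p) (bot_le : ⊥ ≤ W)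
    (fun x hx => hker x hx.2) (n := t) (by simp [ht]) r
  rw [← hcR]
  refine Nat.card_subtype_eq_mul (fun H : AddSubgroup G => H.map f) (fun H hH => ?_) fun R hR => ?_
  · simpa using hH.1
  · replace hR : R ≤ W ∧ Nat.card R = p ^ r := by simpa using hR
    have hRker : R ≤ f.ker := hR.1.trans inf_le_right
    have hcS := card_between_eq_gaussBinom (p := p) hRker
      (fun x hx => (hker x hx).symm ▸ R.zero_mem) (n := k - r)
      (by rw [hk, hR.2, ← pow_add]; congr 1; omega) s
    rw [← hcS]
    refine Nat.card_subtype_eq_mul (fun H : AddSubgroup G => f.ker ⊓ H) (fun H hH => ?_)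
      fun S hS => ?_
    · obtain ⟨⟨⟨h1, h2⟩, h3⟩, rfl⟩ := hH
      refine ⟨⟨le_inf hRker ?_, inf_le_left⟩, by rw [h3, h2]⟩
      -- `p • H ≤ H` since `H` is a subgroup
      rintro _ ⟨x, hx, rfl⟩
      exact H.nsmul_mem hx p
    · obtain ⟨⟨hRS, hS⟩, hSc⟩ := hS
      rw [hR.2] at hSc
      have h4 := card_map_eq_and_inf_eq (hR.1.trans inf_le_left) hRS hS hR.2 (a := k - r - s)
        (by rw [hk, hSc, ← pow_add, ← pow_add]; congr 1; omega)
      rw [← Nat.cast_pow, ← h4]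
      congr 1
      refine Nat.card_congr (Equiv.subtypeEquivRight fun H => ?_)
      constructor
      · rintro ⟨⟨-, h1⟩, h2⟩
        exact ⟨h1, h2⟩
      · rintro ⟨rfl, rfl⟩
        exact ⟨⟨⟨hR, hSc⟩, rfl⟩, rfl⟩

/-- Only the ranks `k` of `G[p]` and `t` of `pG ∩ G[p]` matter for the number of subgroups of
exponent `p ^ 2`; they are sorted by the ranks `r` of `p • H` and `r + s` of `H ∩ G[p]`. -/
theorem ncard_subgroupsOfExponent_prime_sq {k t : ℕ} (htk : t ≤ k)
    (hk : Nat.card (nsmulAddMonoidHom p : G →+ G).ker = p ^ k)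
    (ht : Nat.card ((nsmulAddMonoidHom p : G →+ G).range ⊓ (nsmulAddMonoidHom p).ker :
      AddSubgroup G) = p ^ t) :
    ((subgroupsOfExponent (p ^ 2) G).ncard : ℚ) =
      ∑ r ∈ Finset.Icc 1 t, ∑ s ∈ Finset.Icc 0 (k - r),
        (p : ℚ) ^ (r * (k - r - s)) * gaussBinom p (k - r) s * gaussBinom p t r := by
  have hp : p.Prime := Fact.out
  set f : G →+ G := nsmulAddMonoidHom p with hf
  have h1 : (subgroupsOfExponent (p ^ 2) G).ncard =
      Nat.card {H : AddSubgroup G // H.map f ≤ f.range ⊓ f.ker ∧ H.map f ≠ ⊥} :=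
    Nat.card_congr (Equiv.subtypeEquivRight fun H => exponent_eq_prime_sq_iff hp H)
  rw [h1, Nat.card_subtype_eq_sum_card (fun H => Nat.log p (Nat.card (H.map f))) (Finset.Icc 1 t),
    Nat.cast_sum]
  · refine Finset.sum_congr rfl fun r hr => ?_
    obtain ⟨hr1, hrt⟩ := Finset.mem_Icc.1 hr
    rw [Nat.card_subtype_eq_sum_card
      (fun H => Nat.log p (Nat.card (f.ker ⊓ H : AddSubgroup G)) - r) (Finset.Icc 0 (k - r)),
      Nat.cast_sum]
    · refine Finset.sum_congr rfl fun s hs => ?_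
      have hs' := (Finset.mem_Icc.1 hs).2
      rw [← card_map_card_eq_and_card_inf_eq hrt htk hs' hk ht]
      congr 1
      refine Nat.card_congr (Equiv.subtypeEquivRight fun H => ?_)
      constructor
      · rintro ⟨⟨⟨h2, h3⟩, h4⟩, h5⟩
        obtain ⟨a, ha, h6⟩ := AddSubgroup.exists_card_eq_pow_of_le hp h2 ht
        obtain ⟨b, hb, h7⟩ := AddSubgroup.exists_card_eq_pow_of_le hp
          (inf_le_left : f.ker ⊓ H ≤ f.ker) hk
        -- `p • H ≤ H ∩ G[p]`, so the truncated difference of the ranks is a true one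
        have h8 : H.map f ≤ f.ker ⊓ H := by
          refine le_inf (h2.trans inf_le_right) ?_
          rintro _ ⟨x, hx, rfl⟩
          exact H.nsmul_mem hx p
        have h9 := AddSubgroup.card_dvd_of_le h8
        rw [h6, h7, Nat.pow_dvd_pow_iff_le_right hp.one_lt] at h9
        rw [h6, Nat.log_pow hp.one_lt] at h4
        rw [h7, Nat.log_pow hp.one_lt] at h5
        refine ⟨⟨h2, h4 ▸ h6⟩, ?_⟩
        rw [h7, ← pow_add]
        congr 1
        omega
      · rintro ⟨⟨h2, h3⟩, h4⟩
        rw [← pow_add] at h4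
        refine ⟨⟨⟨h2, fun h5 => ?_⟩, by rw [h3, Nat.log_pow hp.one_lt]⟩,
          by rw [h4, Nat.log_pow hp.one_lt]; omega⟩
        rw [h5, AddSubgroup.card_bot] at h3
        exact absurd h3.symm (Nat.one_lt_pow (by omega) hp.one_lt).ne'
    · rintro H ⟨⟨h2, h3⟩, h4⟩
      obtain ⟨b, hb, h7⟩ := AddSubgroup.exists_card_eq_pow_of_le hp
        (inf_le_left : f.ker ⊓ H ≤ f.ker) hk
      simp only [h7, Nat.log_pow hp.one_lt, Finset.mem_Icc]
      omega
  · rintro H ⟨h2, h3⟩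
    obtain ⟨a, ha, h6⟩ := AddSubgroup.exists_card_eq_pow_of_le hp h2 ht
    rw [h6, Nat.log_pow hp.one_lt, Finset.mem_Icc]
    refine ⟨Nat.one_le_iff_ne_zero.2 ?_, ha⟩
    rintro rfl
    exact h3 (AddSubgroup.eq_bot_of_card_eq _ (by simpa using h6))

end Count

/-! ### Groups of a given type -/

/-- The `n`-torsion is computed factor by factor, a cyclic group of order `m` having `gcd m n`
elements killed by `n`. -/
theorem card_ker_nsmulAddMonoidHom_of_equiv {p k : ℕ} (hp : p.Prime) {lam : Fin k → ℕ} {G : Type*}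
    [AddCommGroup G] (e : G ≃+ ((i : Fin k) → ZMod (p ^ lam i))) (n : ℕ) :
    Nat.card (nsmulAddMonoidHom n : G →+ G).ker = ∏ i, (p ^ lam i).gcd n := by
  have : ∀ i, NeZero (p ^ lam i) := fun i => ⟨pow_ne_zero _ hp.ne_zero⟩
  have h1 : (nsmulAddMonoidHom n : G →+ G).ker ≃
      {y : (i : Fin k) → ZMod (p ^ lam i) // ∀ i, n • y i = 0} :=
    Equiv.subtypeEquiv e.toEquiv fun x => by
      change n • x = 0 ↔ ∀ i, n • e x i = 0
      rw [← e.map_eq_zero_iff, map_nsmul, funext_iff]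
      rfl
  rw [Nat.card_congr (h1.trans (Equiv.subtypePiEquivPi (p := fun i (z : ZMod (p ^ lam i)) =>
    n • z = 0))), Nat.card_pi]
  refine Finset.prod_congr rfl fun i _ => ?_
  have h2 := IsAddCyclic.card_nsmulAddMonoidHom_ker (ZMod (p ^ lam i)) n
  rw [Nat.card_zmod] at h2
  exact h2

theorem mainTheorem9 (p : ℕ) (hp : p.Prime) (k t : ℕ) (htk : t ≤ k) (lam : Fin k → ℕ)
    (ht : ∀ i : Fin k, 2 ≤ lam i ↔ (i : ℕ) < t)
    (G : Type*) [AddCommGroup G] (hG : HasType p lam G) :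
    ((subgroupsOfExponent (p ^ 2) G).ncard : ℚ) =
        ∑ r ∈ Finset.Icc 1 t, ∑ s ∈ Finset.Icc 0 (k - r),
          (p : ℚ) ^ (r * (k - r - s)) * gaussBinom p (k - r) s * gaussBinom p t r ∧
      (t = 0 → (subgroupsOfExponent (p ^ 2) G).ncard = 0) := by
  obtain ⟨-, hlam, ⟨e⟩⟩ := hG
  have : Fact p.Prime := ⟨hp⟩
  have : ∀ i, NeZero (p ^ lam i) := fun i => ⟨pow_ne_zero _ hp.ne_zero⟩
  have : Finite G := Finite.of_equiv _ e.symm.toEquiv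
  have hk : Nat.card (nsmulAddMonoidHom p : G →+ G).ker = p ^ k := by
    rw [card_ker_nsmulAddMonoidHom_of_equiv hp e, Finset.prod_congr rfl (g := fun _ => p)]
    · simp
    · exact fun i _ => Nat.gcd_eq_right (dvd_pow_self p (by have := hlam i; omega))
  have hk2 : Nat.card (nsmulAddMonoidHom (p ^ 2) : G →+ G).ker = p ^ t * p ^ k := by
    rw [card_ker_nsmulAddMonoidHom_of_equiv hp e,
      Finset.prod_congr rfl (g := fun i : Fin k => (if (i : ℕ) < t then p else 1) * p)]
    · rw [Finset.prod_mul_distrib, Finset.prod_ite]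
      simp [Fin.card_filter_val_lt, htk]
    · intro i _
      split_ifs with h
      · rw [Nat.gcd_eq_right (pow_dvd_pow p ((ht i).2 h)), sq]
      · have h1 : lam i = 1 := by
          have := hlam i
          have := mt (ht i).1 h
          omega
        rw [h1, pow_one, one_mul]
        exact Nat.gcd_eq_left (dvd_pow_self p two_ne_zero)
  have ht' : Nat.card ((nsmulAddMonoidHom p : G →+ G).range ⊓ (nsmulAddMonoidHom p).ker :
      AddSubgroup G) = p ^ t := by
    -- `pG ∩ G[p] = p • G[p ^ 2]`
    have h1 : (nsmulAddMonoidHom p : G →+ G).ker ≤ (nsmulAddMonoidHom (p ^ 2) : G →+ G).ker := by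
      intro x hx
      rw [AddMonoidHom.mem_ker, nsmulAddMonoidHom_apply] at hx ⊢
      rw [sq, mul_nsmul, hx, nsmul_zero]
    have h2 : (nsmulAddMonoidHom (p ^ 2) : G →+ G).ker =
        (nsmulAddMonoidHom p : G →+ G).ker.comap (nsmulAddMonoidHom p) := by
      ext x
      simp [AddMonoidHom.mem_ker, sq, mul_nsmul]
    have h3 := AddSubgroup.card_map_mul_card_ker (nsmulAddMonoidHom p : G →+ G) h1
    rw [hk, hk2, h2, AddSubgroup.map_comap_eq] at h3
    exact Nat.eq_of_mul_eq_mul_right (pow_pos hp.pos k) h3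
  have h := ncard_subgroupsOfExponent_prime_sq htk hk ht'
  refine ⟨h, ?_⟩
  rintro rfl
  simpa using h
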